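/- All matroids are finite. For a matroid $M$ with ground set $E$ and rank function $r$, the characteristic polynomial is $$\chi_M(\lambda)=\sum_{F}\mu_M(\emptyset,F)\,\lambda^{r(E)-r(F)}$$ if $M$ is loopless, where $F$ runs over the flats of $M$ and $\mu_M$ is the Möbius function of the lattice of flats of $M$; if $M$ has a loop, $\chi_M$ is defined to be $0$. A tree-decomposition of $M$ is a pair $(T,\tau)$, where $T$ is a finite tree and $\tau:E\to V(T)$ is an arbitrary map. For a vertex $v$ of $T$, let $T_1,\dots,T_c$ be the connected components of $T-v$ and let $B_j=\{e\in E:\tau(e)\in V(T_j)\}$. The node width of $v$ is $$r(E)-\sum_{j=1}^{c}\bigl(r(E)-r(E\setminus B_j)\bigr).$$ The width of $(T,\tau)$ is the maximum node width of its vertices, and the tree-width of $M$ is the minimum width of all tree-decompositions of $M$. Let $U_{2,n}$ denote the uniform matroid of rank $2$ on $n$ elements, where $n\ge 2$. **Theorem 1.4.** Let $q\ge 2$ and $k\ge 0$ be integers, and let $M$ be a matroid with tree-width at most $k$ and no minor isomorphic to $U_{2,q+2}$. Then either $\chi_M$ is identically zero, or $\chi_M(\lambda)>0$ for all real $\lambda>\dfrac{q^k-1}{q-1}$.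 -/

import Mathlib

noncomputable section

open Polynomial

namespace Matroid

variable {α β : Type*}

/-- The rank `r_M(X)` of a set `X` in `M`, as a natural number (used only for finite matroids,
where the `ℕ∞`-valued rank is finite). -/
def rkNat (M : Matroid α) (X : Set α) : ℕ := (M.eRk X).toNat

/-- The flats of `M`, ordered by inclusion: the lattice of flats of `M`. -/
abbrev FlatLattice (M : Matroid α) : Type _ := {F : Set α // M.IsFlat F}

instance instFiniteFlatLattice (M : Matroid α) [M.Finite] : Finite M.FlatLattice :=
  (M.ground_finite.finite_subsets.subset
    (fun F (hF : M.IsFlat F) ↦ hF.subset_ground)).to_subtype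

instance instFintypeFlatLattice (M : Matroid α) [M.Finite] : Fintype M.FlatLattice :=
  Fintype.ofFinite _

open scoped Classical in
instance instLocallyFiniteOrderFlatLattice (M : Matroid α) [M.Finite] :
    LocallyFiniteOrder M.FlatLattice :=
  Fintype.toLocallyFiniteOrder

open scoped Classical in
/-- The characteristic polynomial `∑_F μ(∅, F) λ ^ (r(E) - r(F))` of a finite matroid, where `F`
runs over the flats and `μ` is the Möbius function of the lattice of flats;
it is `0` if `M` has a loop. (The closure of `∅` is `∅` when `M` is loopless.) -/
def charPolynomial (M : Matroid α) [M.Finite] : ℝ[X] :=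
  if M.Loopless then
    ∑ F : M.FlatLattice,
      C (IncidenceAlgebra.mu ℝ (⟨M.closure ∅, M.isFlat_closure ∅⟩ : M.FlatLattice) F) *
        X ^ (M.rkNat M.E - M.rkNat F.1)
  else 0

/-- The uniform matroid `U_{r,n}` on the ground set `{0, …, n - 1}`: the independent sets are the
sets of at most `r` elements. -/
def uniform (r n : ℕ) : Matroid (Fin n) :=
  (IndepMatroid.ofFinite (E := Set.univ) Set.finite_univ
    (Indep := fun I ↦ I.ncard ≤ r)
    (indep_empty := by simp)
    (indep_subset := fun I J hJ hIJ ↦ (Set.ncard_le_ncard hIJ J.toFinite).trans hJ)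
    (indep_aug := fun I J _ hJ hIJ ↦ by
      obtain ⟨e, heJ, heI⟩ := Set.exists_mem_notMem_of_ncard_lt_ncard hIJ I.toFinite
      refine ⟨e, heJ, heI, ?_⟩
      rw [Set.ncard_insert_of_notMem heI I.toFinite]
      omega)
    (subset_ground := fun I _ ↦ Set.subset_univ I)).matroid

/-- Two matroids are isomorphic if some bijection of their ground sets preserves independence in
both directions. -/
def IsIsomorphic (M : Matroid α) (N : Matroid β) : Prop :=
  ∃ e : M.E ≃ N.E, ∀ I : Set M.E,
    M.Indep (Subtype.val '' I) ↔ N.Indep (Subtype.val '' (e '' I))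

/-- `M` has a minor isomorphic to `N`. -/
def HasMinorIsomorphicTo (M : Matroid α) (N : Matroid β) : Prop :=
  ∃ M' : Matroid α, M' ≤m M ∧ M'.IsIsomorphic N

/-- A tree-decomposition of `M` whose tree has vertex set `V`: a tree together with an arbitrary
map `τ` from the elements of `M` to the vertices. (`τ` is defined on all of `α`; its values
outside the ground set `M.E` are never used.) -/
structure TreeDecomposition (M : Matroid α) (V : Type*) where
  /-- the tree -/
  tree : SimpleGraph V
  isTree : tree.IsTree
  /-- the map placing each element in the bag of a vertex -/
  τ : α → V

/-- The rank defect `r(M) - r(E(M) - B)` of a set `B`. -/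
def rankDefect (M : Matroid α) (B : Set α) : ℤ :=
  (M.rkNat M.E : ℤ) - (M.rkNat (M.E \ B) : ℤ)

namespace TreeDecomposition

variable {M : Matroid α} {V : Type*}

/-- The subset of `E(M)` displayed by the vertex `v` that corresponds to the component `K` of
`T - v`: the elements placed at the vertices of `K`. -/
def displayed (D : M.TreeDecomposition V) (v : V)
    (K : (D.tree.induce {w | w ≠ v}).ConnectedComponent) : Set α :=
  {e ∈ M.E | ∃ w ∈ K.supp, w.1 = D.τ e}

/-- The node width of `v`: the rank of `M` minus the sum, over the components of `T - v`, of the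
rank defects of the displayed sets. (Used only for finite trees.) -/
def nodeWidth (D : M.TreeDecomposition V) (v : V) : ℤ :=
  (M.rkNat M.E : ℤ) -
    ∑ᶠ K : (D.tree.induce {w | w ≠ v}).ConnectedComponent, M.rankDefect (D.displayed v K)

/-- `w` is the width of the tree-decomposition, that is, the maximum of its node widths. -/
def HasWidth (D : M.TreeDecomposition V) (w : ℤ) : Prop :=
  IsGreatest (Set.range D.nodeWidth) w

end TreeDecomposition

/-- The tree-width of `M`: the minimum width of all tree-decompositions of `M`, over all finite
trees (up to isomorphism, the trees on the vertex sets `{0, …, n - 1}`). Node widths are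
nonnegative, so this minimum is a natural number. -/
def treeWidth (M : Matroid α) : ℕ :=
  sInf {w : ℕ | ∃ (n : ℕ) (D : M.TreeDecomposition (Fin n)), D.HasWidth (w : ℤ)}

end Matroid

end

/-! Loops make the polynomial zero by definition, so let `M` be loopless and induct on the size of
the ground set. By deletion–contraction, if `X` is a cocircuit and the characteristic polynomials of
all proper minors are nonnegative at `x`, then the value for `M` is at least `x - |X|` times the
value for `M ＼ X` (`le_charSum_of_cocircuit`). It therefore suffices to find a cocircuit with at
most `(q ^ k - 1) / (q - 1)` elements.

Parallel elements can be deleted, so `M` may be taken simple. Kung's bound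
(`ncard_le_of_not_hasMinorIsomorphicTo_uniform`) then reduces the task to finding a cocircuit of
rank at most `k`. A tree-decomposition of width at most `k` provides one: some set of rank at most
`k` has nonspanning complement (`exists_nonspanning_compl`), and such a set contains a cocircuit.
The induction runs because width bounds and excluded minors pass to minors. -/

namespace Matroid

open Set

variable {α : Type*} {M : Matroid α} {e : α} {X Y : Set α}

/-! ### Rank function of a finite matroid -/

section Rank

lemma coe_rkNat (M : Matroid α) [M.Finite] (X : Set α) : (M.rkNat X : ℕ∞) = M.eRk X :=
  ENat.natCast_toNat (eRk_ne_top_iff.2 (M.isRkFinite_set X))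

lemma rkNat_mono (M : Matroid α) [M.Finite] (h : X ⊆ Y) : M.rkNat X ≤ M.rkNat Y := by
  have := M.eRk_mono h
  rw [← coe_rkNat, ← coe_rkNat] at this
  exact_mod_cast this

lemma rkNat_submod (M : Matroid α) [M.Finite] (X Y : Set α) :
    M.rkNat (X ∩ Y) + M.rkNat (X ∪ Y) ≤ M.rkNat X + M.rkNat Y := by
  have := M.eRk_inter_add_eRk_union_le X Y
  simp only [← coe_rkNat] at this
  exact_mod_cast this

lemma rkNat_insert_le (M : Matroid α) [M.Finite] (e : α) (X : Set α) :
    M.rkNat (insert e X) ≤ M.rkNat X + 1 := by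
  have := M.eRk_insert_le_add_one e X
  simp only [← coe_rkNat] at this
  exact_mod_cast this

@[simp] lemma rkNat_empty (M : Matroid α) : M.rkNat ∅ = 0 := by simp [rkNat]

lemma rkNat_inter_ground (M : Matroid α) (X : Set α) : M.rkNat (X ∩ M.E) = M.rkNat X := by
  simp [rkNat]

lemma rkNat_le_ground (M : Matroid α) [M.Finite] (X : Set α) : M.rkNat X ≤ M.rkNat M.E := by
  rw [← rkNat_inter_ground]
  exact M.rkNat_mono inter_subset_right

@[simp] lemma rkNat_closure (M : Matroid α) (X : Set α) : M.rkNat (M.closure X) = M.rkNat X := by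
  simp [rkNat]

lemma Indep.rkNat_eq {I : Set α} (hI : M.Indep I) : M.rkNat I = I.ncard := by
  rw [rkNat, hI.eRk_eq_encard, ncard_def]

lemma indep_iff_rkNat_eq_ncard [M.Finite] {I : Set α} (hI : I.Finite) :
    M.Indep I ↔ M.rkNat I = I.ncard := by
  rw [indep_iff_eRk_eq_encard_of_finite hI, ← coe_rkNat, ← hI.cast_ncard_eq]
  norm_cast

lemma IsNonloop.rkNat_eq (he : M.IsNonloop e) : M.rkNat {e} = 1 := by
  simp [rkNat, he.eRk_eq]

lemma isNonloop_of_rkNat_lt_insert [M.Finite] (h : M.rkNat X < M.rkNat (insert e X)) :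
    M.IsNonloop e := by
  have h1 := M.rkNat_submod {e} X
  rw [singleton_union] at h1
  have h2 : M.rkNat {e} ≤ 1 := by simpa using M.rkNat_insert_le e ∅
  rw [← eRk_singleton_eq_one_iff, ← coe_rkNat]
  norm_cast
  omega

/-- The increase of rank caused by adding `e` is smaller for larger sets. -/
lemma rkNat_insert_add_le (M : Matroid α) [M.Finite] (h : X ⊆ Y) (e : α) :
    M.rkNat (insert e Y) + M.rkNat X ≤ M.rkNat (insert e X) + M.rkNat Y := by
  have h1 := M.rkNat_submod (insert e X) Y
  have h2 : M.rkNat X ≤ M.rkNat (insert e X ∩ Y) :=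
    M.rkNat_mono (subset_inter (subset_insert _ _) h)
  rw [insert_union, union_eq_self_of_subset_left h] at h1
  omega

lemma rkNat_delete (M : Matroid α) (D X : Set α) : (M ＼ D).rkNat X = M.rkNat (X \ D) := by
  rw [rkNat, delete_eq_restrict, restrict_eRk_eq', rkNat, ← inter_sdiff_assoc,
    inter_comm, inter_sdiff_assoc, eRk_ground_inter]

lemma rkNat_contractElem (M : Matroid α) [M.Finite] (he : M.IsNonloop e) (X : Set α) :
    (M ／ {e}).rkNat X + 1 = M.rkNat (insert e X) := by
  obtain ⟨J, hJ, heJ⟩ := he.indep.subset_isBasis'_of_subset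
    (singleton_subset_iff.2 (mem_insert e X))
  have heJ' : e ∈ J := heJ rfl
  have h := hJ.contract_isBasis'_sdiff_of_subset heJ
  have h1 : (M ／ {e}).rkNat X = (J \ {e}).ncard := by
    rw [← rkNat_inter_ground,
      show X ∩ (M ／ {e}).E = insert e X ∩ (M ／ {e}).E by ext a; simp; grind,
      rkNat_inter_ground, rkNat, ← h.encard_eq_eRk, ncard_def]
  rw [h1, rkNat, ← hJ.encard_eq_eRk, ← ncard_def]
  exact ncard_sdiff_singleton_add_one heJ' (M.ground_finite.subset hJ.indep.subset_ground)

end Rank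

/-! ### Boolean expansion and deletion–contraction -/

section CharSum

open scoped Classical in
/-- The Boolean expansion of the characteristic polynomial, evaluated at `x`. -/
noncomputable def charSum (M : Matroid α) [M.Finite] (x : ℝ) : ℝ :=
  ∑ A ∈ M.ground_finite.toFinset.powerset,
    (-1) ^ A.card * x ^ (M.rkNat M.E - M.rkNat (A : Set α))

open scoped Classical in
-- Pairs each `A` avoiding `e` with `insert e A`. The loop, coloop and deletion–contraction formulas
-- are read off from this sum term by term.
lemma charSum_eq_sum_insert (M : Matroid α) [M.Finite] (x : ℝ) (he : e ∈ M.E) :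
    M.charSum x = ∑ A ∈ (M ＼ {e}).ground_finite.toFinset.powerset,
      (-1) ^ A.card * (x ^ (M.rkNat M.E - M.rkNat (A : Set α))
        - x ^ (M.rkNat M.E - M.rkNat (insert e (A : Set α)))) := by
  have h1 : M.ground_finite.toFinset = insert e (M ＼ {e}).ground_finite.toFinset := by
    ext a; simp; grind
  have h2 : e ∉ (M ＼ {e}).ground_finite.toFinset := by simp
  rw [charSum, h1, Finset.sum_powerset_insert h2, ← Finset.sum_add_distrib]
  refine Finset.sum_congr rfl fun A hA ↦ ?_
  have h3 : e ∉ A := fun h ↦ h2 (Finset.mem_powerset.1 hA h)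
  rw [Finset.card_insert_of_notMem h3, Finset.coe_insert]
  ring

lemma charSum_eq_zero_of_isLoop [M.Finite] (he : M.IsLoop e) (x : ℝ) : M.charSum x = 0 := by
  rw [charSum_eq_sum_insert M x he.mem_ground]
  refine Finset.sum_eq_zero fun A _ ↦ ?_
  have : M.rkNat (insert e (A : Set α)) = M.rkNat (A : Set α) := by
    rw [← rkNat_closure, closure_insert_eq_of_mem_closure (he.mem_closure _), rkNat_closure]
  rw [this, sub_self, mul_zero]

lemma rkNat_delete_of_mem_powerset [M.Finite] {A : Finset α}
    (hA : A ∈ (M ＼ {e}).ground_finite.toFinset.powerset) :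
    (M ＼ {e}).rkNat (A : Set α) = M.rkNat (A : Set α) := by
  rw [rkNat_delete, sdiff_singleton_eq_self]
  intro h
  simpa using Finset.mem_powerset.1 hA h

lemma rkNat_ground_delete (M : Matroid α) (D : Set α) :
    (M ＼ D).rkNat (M ＼ D).E = M.rkNat (M.E \ D) := by
  rw [rkNat_delete, delete_ground, sdiff_sdiff, union_self]

/-- Deletion–contraction. -/
lemma charSum_eq_delete_sub_contract [M.Finite] (he : M.IsNonloop e)
    (h : M.rkNat (M.E \ {e}) = M.rkNat M.E) (x : ℝ) :
    M.charSum x = (M ＼ {e}).charSum x - (M ／ {e}).charSum x := by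
  rw [charSum_eq_sum_insert M x he.mem_ground, charSum, charSum]
  have hE : (M ／ {e}).ground_finite.toFinset = (M ＼ {e}).ground_finite.toFinset := by
    ext a; simp
  rw [hE, ← Finset.sum_sub_distrib]
  refine Finset.sum_congr rfl fun A hA ↦ ?_
  rw [rkNat_delete_of_mem_powerset hA, rkNat_ground_delete, h]
  have h1 := M.rkNat_contractElem he (M ／ {e}).E
  have h2 := M.rkNat_contractElem he A
  rw [contract_ground, insert_sdiff_singleton, insert_eq_of_mem he.mem_ground] at h1
  rw [← h1, ← h2, contract_ground, Nat.add_sub_add_right]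
  ring

/-- By submodularity a coloop raises the rank of every set avoiding it by one, so each pair `A`,
`insert e A` carries the factor `x - 1`. -/
lemma charSum_eq_of_coloop [M.Finite] (he : e ∈ M.E)
    (h : M.rkNat (M.E \ {e}) + 1 = M.rkNat M.E) (x : ℝ) :
    M.charSum x = (x - 1) * (M ＼ {e}).charSum x := by
  rw [charSum_eq_sum_insert M x he, charSum, Finset.mul_sum]
  refine Finset.sum_congr rfl fun A hA ↦ ?_
  have hAE : (A : Set α) ⊆ M.E \ {e} := by
    intro a ha
    simpa using Finset.mem_powerset.1 hA ha
  have h1 := M.rkNat_insert_add_le hAE e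
  have h2 := M.rkNat_insert_le e A
  have h3 := M.rkNat_mono hAE
  rw [insert_sdiff_singleton, insert_eq_of_mem he] at h1
  rw [rkNat_delete_of_mem_powerset hA, rkNat_ground_delete,
    show M.rkNat (insert e (A : Set α)) = M.rkNat (A : Set α) + 1 by omega, ← h,
    Nat.add_sub_add_right, Nat.sub_add_comm h3, pow_succ]
  ring

open scoped Classical in
/-- The Möbius function of the lattice of flats of a loopless matroid is given by a signed count
of the sets spanning a flat. -/
lemma mu_flatLattice_eq [M.Finite] [M.Loopless] (F : M.FlatLattice) :
    IncidenceAlgebra.mu ℝ (⟨M.closure ∅, M.isFlat_closure ∅⟩ : M.FlatLattice) F =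
      ∑ A ∈ M.ground_finite.toFinset.powerset.filter fun A : Finset α ↦ M.closure A = F.1,
        (-1 : ℝ) ^ A.card := by
  induction F using WellFoundedLT.induction with
  | ind F ih =>
  set O : M.FlatLattice := ⟨M.closure ∅, M.isFlat_closure ∅⟩ with hO
  have hOle (G : M.FlatLattice) : O ≤ G := by
    change M.closure ∅ ⊆ G.1
    rw [← G.2.closure]
    exact M.closure_subset_closure (empty_subset _)
  have h1 := IncidenceAlgebra.sum_Icc_mu_right (𝕜 := ℝ) O F
  have hF : F.1.Finite := M.ground_finite.subset F.2.subset_ground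
  -- The signed counts satisfy the recursion that defines `mu`: summed over the flats below `F` they
  -- run over all subsets of `F`, and the alternating sum vanishes unless `F` is empty.
  have h2 : ∑ G ∈ Finset.Icc O F, ∑ A ∈ M.ground_finite.toFinset.powerset.filter
      fun A : Finset α ↦ M.closure A = G.1, (-1 : ℝ) ^ A.card = if O = F then 1 else 0 := by
    have h3 : ∑ A ∈ hF.toFinset.powerset, (-1 : ℝ) ^ A.card = if O = F then 1 else 0 := by
      have := congrArg (Int.cast (R := ℝ)) (Finset.sum_powerset_neg_one_pow_card (x := hF.toFinset))
      push_cast at this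
      rw [this]
      refine if_congr ?_ rfl rfl
      rw [hF.toFinset_eq_empty, Subtype.ext_iff, hO]
      simp only [closure_empty, loops_eq_empty]
      exact eq_comm
    rw [← h3]
    have := Finset.sum_fiberwise_of_maps_to (s := hF.toFinset.powerset) (t := Finset.Icc O F)
      (g := fun A : Finset α ↦ (⟨M.closure (A : Set α), M.isFlat_closure A⟩ : M.FlatLattice))
      (fun A hA ↦ by
        refine Finset.mem_Icc.2 ⟨hOle _, ?_⟩
        change M.closure A ⊆ F.1
        refine (M.closure_subset_closure ?_).trans F.2.closure.subset
        simpa [← Finset.coe_subset] using hA) (fun A ↦ (-1 : ℝ) ^ A.card)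
    rw [← this]
    refine Finset.sum_congr rfl fun G hG ↦ Finset.sum_congr ?_ fun _ _ ↦ rfl
    ext A
    have hGF : G.1 ⊆ F.1 := (Finset.mem_Icc.1 hG).2
    simp only [Finset.mem_filter, Finset.mem_powerset, ← Finset.coe_subset,
      Finite.coe_toFinset, Subtype.ext_iff]
    refine and_congr_left fun hA ↦ ⟨fun h ↦ ?_, fun h ↦ h.trans F.2.subset_ground⟩
    exact (M.subset_closure A h).trans (hA.subset.trans hGF)
  rw [← Finset.Ico_insert_right (hOle F), Finset.sum_insert (by simp)] at h1 h2
  rw [Finset.sum_congr rfl fun G hG ↦ ih G (Finset.mem_Ico.1 hG).2] at h1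
  linarith

/-- Group the subsets of the ground set by closure: rank depends only on the closure, and each group
contributes a Möbius value. -/
theorem eval_charPolynomial [M.Finite] [M.Loopless] (x : ℝ) :
    M.charPolynomial.eval x = M.charSum x := by
  classical
  rw [charPolynomial, if_pos ‹_›, charSum, Polynomial.eval_finsetSum]
  rw [← Finset.sum_fiberwise (s := M.ground_finite.toFinset.powerset)
    (g := fun A : Finset α ↦ (⟨M.closure (A : Set α), M.isFlat_closure A⟩ : M.FlatLattice))]
  refine Finset.sum_congr rfl fun F _ ↦ ?_
  rw [Polynomial.eval_mul, Polynomial.eval_C, Polynomial.eval_pow, Polynomial.eval_X,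
    mu_flatLattice_eq, Finset.sum_mul]
  simp only [Subtype.ext_iff]
  refine Finset.sum_congr rfl fun A hA ↦ ?_
  rw [← (Finset.mem_filter.1 hA).2, rkNat_closure]

end CharSum

end Matroid

/-! ### Components of a tree minus a vertex -/

namespace SimpleGraph

open Set

variable {V : Type*} {G : SimpleGraph V}

/-- `a` and `b` lie in a common component of `G - v`, expressed by a walk of `G`. -/
lemma reachable_induce_ne_iff {v : V} {a b : V} (ha : a ≠ v) (hb : b ≠ v) :
    (G.induce {w | w ≠ v}).Reachable ⟨a, ha⟩ ⟨b, hb⟩ ↔ ∃ p : G.Walk a b, v ∉ p.support := by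
  constructor
  · rintro ⟨p⟩
    refine ⟨p.map (Embedding.induce {w | w ≠ v}).toHom, fun h ↦ ?_⟩
    obtain ⟨w, -, hw⟩ := List.mem_map.1 (Walk.support_map _ p ▸ h)
    exact w.2 hw
  · rintro ⟨p, hp⟩
    exact ⟨p.induce {w | w ≠ v} fun x hx hxv ↦ hp (hxv ▸ hx)⟩

lemma Connected.exists_adj_mem_supp (hG : G.Connected) (v : V)
    (K : (G.induce {w | w ≠ v}).ConnectedComponent) : ∃ u ∈ K.supp, G.Adj v u.1 := by
  obtain ⟨⟨w, hwv⟩, hw⟩ := K.nonempty_supp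
  obtain ⟨p, hp⟩ := (hG v w).exists_isPath
  cases p with
  | nil => exact absurd rfl hwv
  | cons h p =>
    rename_i u
    rw [Walk.cons_isPath_iff] at hp
    have hu : u ≠ v := h.ne'
    refine ⟨⟨u, hu⟩, ?_, h⟩
    rw [ConnectedComponent.mem_supp_iff] at hw ⊢
    rw [← hw, ConnectedComponent.eq]
    exact (reachable_induce_ne_iff hu hwv).2 ⟨p, hp.2⟩

/-- Moving across an edge `vu`: a component of `G - u` that does not contain `v` is contained in
the component of `G - v` containing `u`. -/
lemma Connected.mem_supp_of_mem_supp_ne (hG : G.Connected) {u v : V} (huv : u ≠ v)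
    {K : (G.induce {w | w ≠ v}).ConnectedComponent} (hu : ⟨u, huv⟩ ∈ K.supp)
    {K' : (G.induce {w | w ≠ u}).ConnectedComponent}
    (hK' : K' ≠ (G.induce {w | w ≠ u}).connectedComponentMk ⟨v, huv.symm⟩)
    {w : {w | w ≠ u}} (hw : w ∈ K'.supp) : ∃ hwv : w.1 ≠ v, ⟨w.1, hwv⟩ ∈ K.supp := by
  classical
  rw [ConnectedComponent.mem_supp_iff] at hu hw
  have hno : ¬ ∃ p : G.Walk v w.1, u ∉ p.support := fun h ↦ hK' <| by
    rw [← hw, ConnectedComponent.eq]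
    exact ((reachable_induce_ne_iff huv.symm w.2).2 h).symm
  have hwv : w.1 ≠ v := by
    rintro rfl
    exact hno ⟨Walk.nil, by simpa using huv⟩
  refine ⟨hwv, ?_⟩
  rw [ConnectedComponent.mem_supp_iff, ← hu, ConnectedComponent.eq]
  refine Reachable.symm ((reachable_induce_ne_iff huv hwv).2 ?_)
  obtain ⟨p, hp⟩ := (hG u w.1).exists_isPath
  -- If the path from `u` to `w` met `v`, its tail from `v` would avoid the starting vertex `u`,
  -- contradicting `hno`.
  refine ⟨p, fun hv ↦ hno ⟨p.dropUntil v hv, fun hu' ↦ ?_⟩⟩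
  have h1 : u ∈ (p.takeUntil v hv).support := Walk.start_mem_support _
  rw [← p.take_spec hv, Walk.isPath_def, Walk.support_append] at hp
  rcases (Walk.mem_support_iff _).1 hu' with h2 | h2
  · exact huv h2
  · exact (List.disjoint_of_nodup_append hp) h1 h2

/-- For an edge `vu` of an acyclic graph, the component of `G - v` containing `u` is disjoint from
the component of `G - u` containing `v`. -/
lemma IsAcyclic.notMem_supp_of_mem_supp (hG : G.IsAcyclic) {u v w : V} (huv : G.Adj v u)
    (hwu : w ≠ u) (hwv : w ≠ v)
    (h1 : (G.induce {w | w ≠ v}).Reachable ⟨u, huv.ne'⟩ ⟨w, hwv⟩)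
    (h2 : (G.induce {w | w ≠ u}).Reachable ⟨v, huv.ne⟩ ⟨w, hwu⟩) : False := by
  classical
  obtain ⟨p, hp⟩ := (reachable_induce_ne_iff _ _).1 h1
  obtain ⟨p', hp'⟩ := (reachable_induce_ne_iff _ _).1 h2
  -- Two paths from `v` to `w` arise, one starting with the edge `vu` and one avoiding `u`; an
  -- acyclic graph has only one.
  have hpath : (Walk.cons huv p.bypass).IsPath :=
    (Walk.cons_isPath_iff _ _).2 ⟨p.bypass_isPath, fun h ↦ hp (p.support_bypass_subset_support h)⟩
  have heq : Walk.cons huv p.bypass = p'.bypass := congrArg Subtype.val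
    ((hG.subsingleton_path v w).elim ⟨_, hpath⟩ ⟨_, p'.bypass_isPath⟩)
  have h3 : u ∈ p'.bypass.support := by
    rw [← heq]
    simp
  exact hp' (p'.support_bypass_subset_support h3)

end SimpleGraph

/-! ### Tree-decompositions and sets with nonspanning complement -/

namespace Matroid

open Set

variable {α : Type*} {M N : Matroid α} {e f : α} {X Y S : Set α} {V : Type*}

namespace TreeDecomposition

lemma displayed_subset (D : M.TreeDecomposition V) (v : V)
    (K : (D.tree.induce {w | w ≠ v}).ConnectedComponent) : D.displayed v K ⊆ M.E :=
  fun _ h ↦ h.1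

lemma rankDefect_nonneg (M : Matroid α) [M.Finite] (B : Set α) : 0 ≤ M.rankDefect B := by
  have := M.rkNat_le_ground (M.E \ B)
  simp only [rankDefect]
  omega

lemma displayed_disjoint (D : M.TreeDecomposition V) (v : V)
    {K L : (D.tree.induce {w | w ≠ v}).ConnectedComponent} (h : K ≠ L) :
    Disjoint (D.displayed v K) (D.displayed v L) := by
  rw [Set.disjoint_left]
  rintro e ⟨-, w, hw, hwe⟩ ⟨-, w', hw', hwe'⟩
  obtain rfl : w = w' := Subtype.ext (hwe.trans hwe'.symm)
  exact h (hw.symm.trans hw')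

/-- Take a component `K` of some `T - v` with positive defect and as few vertices as possible, and
step to the neighbour `u` of `v` in `K`. Components of `T - u` away from `v` are smaller than `K`,
so they have defect zero, and the node width of `u` is the rank of the complement of what the
remaining component `K₀` displays. That complement is the required `L`. -/
lemma exists_nonspanning_compl_of_rankDefect_pos [M.Finite] [Finite V]
    (D : M.TreeDecomposition V) {w : ℤ} (hD : ∀ v, D.nodeWidth v ≤ w)
    (h : ∃ v K, 0 < M.rankDefect (D.displayed v K)) :
    ∃ L ⊆ M.E, (M.rkNat L : ℤ) ≤ w ∧ M.rkNat (M.E \ L) < M.rkNat M.E := by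
  classical
  let S : Set (Σ v, (D.tree.induce {w | w ≠ v}).ConnectedComponent) :=
    {x | 0 < M.rankDefect (D.displayed x.1 x.2)}
  have hS : S.Nonempty := by
    obtain ⟨v, K, hK⟩ := h
    exact ⟨⟨v, K⟩, hK⟩
  obtain ⟨⟨v, K⟩, hvK, hmin⟩ := exists_minimalFor_of_wellFoundedLT (· ∈ S)
    (fun x ↦ (Subtype.val '' x.2.supp : Set V).ncard) hS
  obtain ⟨⟨u, huv⟩, huK, hadj⟩ := D.isTree.connected.exists_adj_mem_supp v K
  set K₀ := (D.tree.induce {w | w ≠ u}).connectedComponentMk ⟨v, huv.symm⟩ with hK₀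
  have hzero (K' : (D.tree.induce {w | w ≠ u}).ConnectedComponent) (hK' : K' ≠ K₀) :
      M.rankDefect (D.displayed u K') = 0 := by
    refine le_antisymm (not_lt.1 fun hpos ↦ ?_) (rankDefect_nonneg M _)
    have hss : (Subtype.val '' K'.supp : Set V) ⊂ Subtype.val '' K.supp := by
      refine (ssubset_iff_of_subset ?_).2 ⟨u, ⟨_, huK, rfl⟩, ?_⟩
      · rintro _ ⟨w, hw, rfl⟩
        obtain ⟨hwv, hwK⟩ := D.isTree.connected.mem_supp_of_mem_supp_ne huv huK hK' hw
        exact ⟨_, hwK, rfl⟩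
      · rintro ⟨w, -, hw⟩
        exact w.2 hw
    have hlt := ncard_lt_ncard hss (toFinite _)
    have := hmin (j := ⟨u, K'⟩) hpos hlt.le
    exact absurd this (not_le.2 hlt)
  have hsum : ∑ᶠ K', M.rankDefect (D.displayed u K') = M.rankDefect (D.displayed u K₀) :=
    finsum_eq_single _ K₀ hzero
  have hwidth := hD u
  rw [nodeWidth, hsum, rankDefect] at hwidth
  refine ⟨M.E \ D.displayed u K₀, sdiff_subset, by linarith, ?_⟩
  rw [sdiff_sdiff_cancel_left (D.displayed_subset u K₀)]
  -- Beyond the edge `uv`, the component `K₀` is disjoint from `K`, whose displayed set has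
  -- nonspanning complement.
  have hle : M.rkNat (D.displayed u K₀) ≤ M.rkNat (M.E \ D.displayed v K) := by
    refine M.rkNat_mono ?_
    rintro a ⟨haE, w, hw, hwa⟩
    refine ⟨haE, ?_⟩
    rintro ⟨-, w', hw', hwa'⟩
    have hww : w'.1 = w.1 := hwa'.trans hwa.symm
    have hwv : w.1 ≠ v := hww ▸ w'.2
    obtain rfl : w' = ⟨w.1, hwv⟩ := Subtype.ext hww
    refine D.isTree.isAcyclic.notMem_supp_of_mem_supp hadj w.2 hwv ?_ ?_
    · exact SimpleGraph.ConnectedComponent.exact (huK.trans hw'.symm)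
    · exact SimpleGraph.ConnectedComponent.exact (hK₀.symm.trans hw.symm)
  have hvK' : 0 < M.rankDefect (D.displayed v K) := hvK
  rw [rankDefect] at hvK'
  omega

/-- A matroid of positive rank with a tree-decomposition of width at most `w` has a set of rank at
most `w` whose complement is not spanning. -/
lemma exists_nonspanning_compl [M.Finite] [Finite V] (D : M.TreeDecomposition V) {w : ℤ}
    (hD : ∀ v, D.nodeWidth v ≤ w) (hM : 0 < M.rkNat M.E) :
    ∃ L ⊆ M.E, (M.rkNat L : ℤ) ≤ w ∧ M.rkNat (M.E \ L) < M.rkNat M.E := by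
  by_cases h : ∃ v K, 0 < M.rankDefect (D.displayed v K)
  · exact D.exists_nonspanning_compl_of_rankDefect_pos hD h
  push Not at h
  obtain ⟨v⟩ := D.isTree.connected.nonempty
  -- With all defects zero, every node width equals the rank of `M`.
  refine ⟨M.E, subset_rfl, ?_, by simpa using hM⟩
  have hsum : ∑ᶠ K, M.rankDefect (D.displayed v K) = 0 :=
    finsum_eq_zero_of_forall_eq_zero fun K ↦ le_antisymm (h v K) (rankDefect_nonneg M _)
  have := hD v
  rw [nodeWidth, hsum] at this
  linarith

/-! ### Width under minors -/

/-- The same tree and map, as a tree-decomposition of another matroid. -/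
def transfer (D : M.TreeDecomposition V) (N : Matroid α) : N.TreeDecomposition V :=
  ⟨D.tree, D.isTree, D.τ⟩

lemma displayed_transfer (D : M.TreeDecomposition V) (hN : N.E ⊆ M.E) (v : V)
    (K : (D.tree.induce {w | w ≠ v}).ConnectedComponent) :
    (D.transfer N).displayed v K = D.displayed v K ∩ N.E := by
  ext e
  constructor
  · exact fun h ↦ ⟨⟨hN h.1, h.2⟩, h.1⟩
  · exact fun h ↦ ⟨h.2, h.1.2⟩

/-- Here `c` is the drop in rank on removing `e`. Displayed sets at `v` are disjoint, so at most one
contains `e`; the defects lose at most `c` in total, which the drop in rank offsets. -/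
lemma nodeWidth_transfer_le_of_rankDefect [Finite V] (D : M.TreeDecomposition V)
    (hN : N.E = M.E \ {e}) {c : ℤ} (hc : 0 ≤ c) (hE : (N.rkNat N.E : ℤ) = M.rkNat M.E - c)
    (hmem : ∀ B ⊆ M.E, e ∈ B → M.rankDefect B ≤ N.rankDefect (B ∩ N.E) + c)
    (hnotMem : ∀ B ⊆ M.E, e ∉ B → M.rankDefect B ≤ N.rankDefect (B ∩ N.E)) (v : V) :
    (D.transfer N).nodeWidth v ≤ D.nodeWidth v := by
  classical
  have hNM : N.E ⊆ M.E := hN ▸ sdiff_subset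
  have : Fintype (D.tree.induce {w | w ≠ v}).ConnectedComponent := Fintype.ofFinite _
  suffices h : ∑ K : (D.tree.induce {w | w ≠ v}).ConnectedComponent,
      M.rankDefect (D.displayed v K) ≤
      ∑ K : (D.tree.induce {w | w ≠ v}).ConnectedComponent,
        N.rankDefect (D.displayed v K ∩ N.E) + c by
    have h' : ∑ᶠ K, N.rankDefect ((D.transfer N).displayed v K) =
        ∑ᶠ K : (D.tree.induce {w | w ≠ v}).ConnectedComponent,
          N.rankDefect (D.displayed v K ∩ N.E) :=
      finsum_congr fun K ↦ congrArg _ (displayed_transfer D hNM v K)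
    rw [nodeWidth, nodeWidth, h', finsum_eq_sum_of_fintype, finsum_eq_sum_of_fintype, hE]
    linarith
  by_cases hex : ∃ K, e ∈ D.displayed v K
  · obtain ⟨K, hK⟩ := hex
    rw [← Finset.add_sum_erase _ _ (Finset.mem_univ K),
      ← Finset.add_sum_erase (a := K) _ (fun K ↦ N.rankDefect _) (Finset.mem_univ K)]
    have h1 := hmem _ (D.displayed_subset v K) hK
    have h2 := Finset.sum_le_sum (s := Finset.univ.erase K)
      fun L hL ↦ hnotMem _ (D.displayed_subset v L)
        (Set.disjoint_left.1 (D.displayed_disjoint v (Finset.ne_of_mem_erase hL).symm) hK)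
    linarith
  · push Not at hex
    have := Finset.sum_le_sum (s := Finset.univ)
      fun L _ ↦ hnotMem _ (D.displayed_subset v L) (hex L)
    linarith

lemma nodeWidth_transfer_deleteElem_le [M.Finite] [Finite V] (D : M.TreeDecomposition V)
    (he : e ∈ M.E) (v : V) : (D.transfer (M ＼ {e})).nodeWidth v ≤ D.nodeWidth v := by
  have h0 := M.rkNat_le_ground (M.E \ {e})
  refine D.nodeWidth_transfer_le_of_rankDefect (e := e)
    (c := M.rkNat M.E - M.rkNat (M.E \ {e})) rfl (by omega)
    (by rw [rkNat_ground_delete]; ring) (fun B hB heB ↦ ?_) (fun B hB heB ↦ ?_) v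
  · rw [rankDefect, rankDefect, rkNat_ground_delete, rkNat_delete]
    rw [show ((M ＼ {e}).E \ (B ∩ (M ＼ {e}).E)) \ {e} = M.E \ B by ext; simp; grind]
    linarith
  · rw [rankDefect, rankDefect, rkNat_ground_delete, rkNat_delete]
    rw [show ((M ＼ {e}).E \ (B ∩ (M ＼ {e}).E)) \ {e} = (M.E \ B) \ {e} by ext; simp; grind]
    -- Deleting `e` lowers the rank of the ground set by no more than that of the smaller set `M.E \
    -- B`.
    have h1 := M.rkNat_insert_add_le
      (show (M.E \ B) \ {e} ⊆ M.E \ {e} from sdiff_subset_sdiff_left sdiff_subset) e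
    rw [insert_sdiff_singleton, insert_sdiff_singleton, insert_eq_of_mem he,
      insert_eq_of_mem (show e ∈ M.E \ B from ⟨he, heB⟩)] at h1
    omega

lemma nodeWidth_transfer_contractElem_le [M.Finite] [Finite V] (D : M.TreeDecomposition V)
    (he : M.IsNonloop e) (v : V) : (D.transfer (M ／ {e})).nodeWidth v ≤ D.nodeWidth v := by
  have h0 := M.rkNat_contractElem he (M ／ {e}).E
  rw [contract_ground, insert_sdiff_singleton, insert_eq_of_mem he.mem_ground] at h0
  refine D.nodeWidth_transfer_le_of_rankDefect (e := e) (c := 1) rfl (by omega)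
    (by rw [contract_ground]; omega) (fun B hB heB ↦ ?_) (fun B hB heB ↦ ?_) v
  · simp only [rankDefect, contract_ground]
    have h1 := M.rkNat_contractElem he ((M.E \ {e}) \ (B ∩ (M.E \ {e})))
    rw [show insert e ((M.E \ {e}) \ (B ∩ (M.E \ {e}))) = insert e (M.E \ B) by
      ext; simp; grind] at h1
    have h2 := M.rkNat_insert_le e (M.E \ B)
    omega
  · simp only [rankDefect, contract_ground]
    have h1 := M.rkNat_contractElem he ((M.E \ {e}) \ (B ∩ (M.E \ {e})))
    have h3 := he.mem_ground
    rw [show insert e ((M.E \ {e}) \ (B ∩ (M.E \ {e}))) = M.E \ B by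
      ext; simp; grind] at h1
    omega

end TreeDecomposition

/-- `M` has a tree-decomposition, over some finite tree, all of whose node widths are at most
`w`. -/
def HasTreeDecompositionOfWidthLE (M : Matroid α) (w : ℤ) : Prop :=
  ∃ (n : ℕ) (D : M.TreeDecomposition (Fin n)), ∀ v, D.nodeWidth v ≤ w

/-- A property closed under deletion of an element and contraction of a nonloop is closed under
minors. -/
lemma IsMinor.property_of_deleteElem_of_contractElem {P : Matroid α → Prop}
    (hdel : ∀ (M : Matroid α) [M.Finite] (e), e ∈ M.E → P M → P (M ＼ {e}))
    (hcon : ∀ (M : Matroid α) [M.Finite] (e), M.IsNonloop e → P M → P (M ／ {e}))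
    [M.Finite] (hNM : N ≤m M) (hM : P M) : P N := by
  have hdel' (M : Matroid α) [M.Finite] (e : α) (h : P M) : P (M ＼ {e}) := by
    by_cases he : e ∈ M.E
    · exact hdel M e he h
    · rwa [deleteElem_eq_self he]
  have hcon' (M : Matroid α) [M.Finite] (e : α) (h : P M) : P (M ／ {e}) := by
    by_cases he : e ∈ M.E
    · obtain he' | he' := M.isLoop_or_isNonloop e
      · rw [contract_eq_delete_of_subset_loops (singleton_subset_iff.2 he')]
        exact hdel M e he h
      · exact hcon M e he' h
    · rwa [contractElem_eq_self he]
  have hdelete (M : Matroid α) [M.Finite] (X : Set α) (h : P M) : P (M ＼ X) := by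
    rw [← delete_inter_ground_eq]
    induction X ∩ M.E, M.ground_finite.subset (inter_subset_right (s := X)) using
      Set.Finite.induction_on with
    | empty => rwa [delete_empty]
    | insert _ _ ih =>
      rw [insert_eq, union_comm, ← delete_delete]
      exact hdel' _ _ ih
  have hcontract (M : Matroid α) [M.Finite] (X : Set α) (h : P M) : P (M ／ X) := by
    rw [← contract_inter_ground_eq]
    induction X ∩ M.E, M.ground_finite.subset (inter_subset_right (s := X)) using
      Set.Finite.induction_on with
    | empty => rwa [contract_empty]
    | insert _ _ ih =>
      rw [insert_eq, union_comm, ← contract_contract]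
      exact hcon' _ _ ih
  obtain ⟨C, D, rfl⟩ := hNM
  exact hdelete _ _ (hcontract _ _ hM)

lemma HasTreeDecompositionOfWidthLE.of_isMinor [M.Finite] {w : ℤ}
    (hM : M.HasTreeDecompositionOfWidthLE w) (hNM : N ≤m M) :
    N.HasTreeDecompositionOfWidthLE w := by
  refine hNM.property_of_deleteElem_of_contractElem
    (P := fun N ↦ N.HasTreeDecompositionOfWidthLE w) ?_ ?_ hM
  · rintro M _ e he ⟨n, D, hD⟩
    exact ⟨n, D.transfer _, fun v ↦ (D.nodeWidth_transfer_deleteElem_le he v).trans (hD v)⟩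
  · rintro M _ e he ⟨n, D, hD⟩
    exact ⟨n, D.transfer _, fun v ↦ (D.nodeWidth_transfer_contractElem_le he v).trans (hD v)⟩

/-- The one-vertex tree has width equal to the rank, so the infimum is over a nonempty set and is
attained; the default value of `sInf ∅` plays no role. -/
lemma exists_hasWidth_treeWidth (M : Matroid α) :
    ∃ (n : ℕ) (D : M.TreeDecomposition (Fin n)), D.HasWidth (M.treeWidth : ℤ) := by
  refine Nat.sInf_mem (s := {w : ℕ | ∃ (n : ℕ) (D : M.TreeDecomposition (Fin n)),
    D.HasWidth (w : ℤ)}) ⟨M.rkNat M.E, 1, ⟨⊥, .of_subsingleton, fun _ ↦ 0⟩, ?_⟩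
  have hw (D : M.TreeDecomposition (Fin 1)) (v : Fin 1) : D.nodeWidth v = M.rkNat M.E := by
    have : IsEmpty (D.tree.induce {w | w ≠ v}).ConnectedComponent :=
      ⟨fun K ↦ K.nonempty_supp.elim fun w _ ↦ w.2 (Subsingleton.elim _ _)⟩
    rw [TreeDecomposition.nodeWidth, finsum_of_isEmpty, sub_zero]
  refine ⟨⟨0, hw _ 0⟩, ?_⟩
  rintro _ ⟨v, rfl⟩
  exact (hw _ v).le

lemma hasTreeDecompositionOfWidthLE_of_treeWidth_le {k : ℕ} (h : M.treeWidth ≤ k) :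
    M.HasTreeDecompositionOfWidthLE k := by
  obtain ⟨n, D, hD⟩ := M.exists_hasWidth_treeWidth
  exact ⟨n, D, fun v ↦ (hD.2 ⟨v, rfl⟩).trans (by exact_mod_cast h)⟩

/-! ### Lines and Kung's bound -/

lemma indep_of_ncard_le_two [M.Finite] (hSE : S ⊆ M.E)
    (hS : ∀ e ∈ S, ∀ f ∈ S, M.Indep {e, f}) (h : S.ncard ≤ 2) : M.Indep S := by
  have hfin := M.ground_finite.subset hSE
  obtain h0 | h1 | h2 : S.ncard = 0 ∨ S.ncard = 1 ∨ S.ncard = 2 := by omega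
  · rw [(ncard_eq_zero hfin).1 h0]
    exact M.empty_indep
  · obtain ⟨a, rfl⟩ := ncard_eq_one.1 h1
    simpa using hS a rfl a rfl
  · obtain ⟨a, b, -, rfl⟩ := ncard_eq_two.1 h2
    exact hS a (by simp) b (by simp)

/-- A set of `n` pairwise independent elements of rank at most two gives a `U_{2,n}`-minor. -/
lemma hasMinorIsomorphicTo_uniform_two [M.Finite] (hSE : S ⊆ M.E)
    (hS : ∀ e ∈ S, ∀ f ∈ S, M.Indep {e, f}) (hr : M.rkNat S ≤ 2) :
    M.HasMinorIsomorphicTo (uniform 2 S.ncard) := by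
  have hfin := M.ground_finite.subset hSE
  have : Finite S := hfin
  refine ⟨M ↾ S, ⟨∅, M.E \ S, by rw [contract_empty, delete_compl hSE]⟩, ?_⟩
  let e : (M ↾ S).E ≃ (uniform 2 S.ncard).E :=
    (Finite.equivFin S).trans (Equiv.Set.univ (Fin S.ncard)).symm
  refine ⟨e, fun I ↦ ?_⟩
  have hI : (Subtype.val '' I : Set α) ⊆ S := by
    rintro _ ⟨x, -, rfl⟩
    exact x.2
  have hcard : (Subtype.val '' (e '' I) : Set (Fin S.ncard)).ncard
      = (Subtype.val '' I : Set α).ncard := by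
    rw [ncard_image_of_injective _ Subtype.val_injective,
      ncard_image_of_injective _ e.injective,
      ncard_image_of_injective _ Subtype.val_injective]
  change (M ↾ S).Indep _ ↔ (Subtype.val '' (e '' I)
    : Set (Fin S.ncard)).ncard ≤ 2
  rw [hcard, restrict_indep_iff, and_iff_left hI]
  refine ⟨fun h ↦ ?_, indep_of_ncard_le_two (hI.trans hSE)
    fun a ha b hb ↦ hS a (hI ha) b (hI hb)⟩
  rw [← h.rkNat_eq]
  exact (M.rkNat_mono hI).trans hr

lemma HasMinorIsomorphicTo.of_isMinor {β : Type*} {U : Matroid β}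
    (h : N.HasMinorIsomorphicTo U) (hNM : N ≤m M) : M.HasMinorIsomorphicTo U := by
  obtain ⟨N', hN', h'⟩ := h
  exact ⟨N', hN'.trans hNM, h'⟩

/-- Adding to `S` elements that are in the closure of `S`, one at a time, keeps the rank. -/
lemma rkNat_union_eq_of_forall_insert [M.Finite] (hX : X.Finite)
    (h : ∀ e ∈ X, M.rkNat (insert e S) = M.rkNat S) : M.rkNat (S ∪ X) = M.rkNat S := by
  induction X, hX using Set.Finite.induction_on with
  | empty => simp
  | @insert a X _ _ ih =>
    have h1 := ih fun e he ↦ h e (mem_insert_of_mem _ he)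
    have h2 := M.rkNat_insert_add_le (subset_union_left (s := S) (t := X)) a
    rw [h a (mem_insert _ _)] at h2
    have h3 := M.rkNat_mono (subset_insert a (S ∪ X))
    rw [union_insert]
    omega

/-- In a matroid without `U_{2,q+2}`-minor, a line through `e` has at most `q` further points. -/
lemma ncard_line_le [M.Finite] {q : ℕ} (hline : ¬ M.HasMinorIsomorphicTo (uniform 2 (q + 2)))
    (hXE : X ⊆ M.E) (hX : ∀ e ∈ X, ∀ f ∈ X, M.Indep {e, f}) (he : e ∈ X)
    (hf : f ∈ X) (hef : e ≠ f) :
    {x ∈ X \ {e} | M.rkNat {x, e, f} ≤ 2}.ncard ≤ q := by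
  by_contra! hlt
  set L := {x ∈ X \ {e} | M.rkNat {x, e, f} ≤ 2} with hL
  have hLX : insert e L ⊆ X := insert_subset he fun x hx ↦ hx.1.1
  have hLfin : L.Finite := M.ground_finite.subset (((subset_insert _ _).trans hLX).trans hXE)
  have hcard : q + 2 ≤ (insert e L).ncard := by
    rw [ncard_insert_of_notMem (fun h ↦ h.1.2 rfl) hLfin]
    omega
  obtain ⟨S, hSL, hS⟩ := exists_subset_card_eq hcard
  have hr : M.rkNat {e, f} = 2 := by rw [(hX e he f hf).rkNat_eq, ncard_pair hef]
  have hrS : M.rkNat S ≤ 2 := by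
    rw [← hr, ← rkNat_union_eq_of_forall_insert (S := {e, f}) hLfin]
    · refine M.rkNat_mono (hSL.trans ?_)
      exact insert_subset (by simp) subset_union_right
    · intro x hx
      exact le_antisymm (hx.2.trans hr.ge) (M.rkNat_mono (subset_insert _ _))
  apply hline
  rw [← hS]
  exact hasMinorIsomorphicTo_uniform_two ((hSL.trans hLX).trans hXE)
    (fun a ha b hb ↦ hX a (hLX (hSL ha)) b (hLX (hSL hb))) hrS

/-- Kung's bound on the number of points of a matroid without `U_{2,q+2}`-minor. -/
theorem ncard_le_of_not_hasMinorIsomorphicTo_uniform [M.Finite] {q : ℕ} (hq : 1 ≤ q)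
    (hline : ¬ M.HasMinorIsomorphicTo (uniform 2 (q + 2)))
    (hXE : X ⊆ M.E) (hX : ∀ e ∈ X, ∀ f ∈ X, M.Indep {e, f}) :
    (q - 1) * X.ncard + 1 ≤ q ^ M.rkNat X := by
  induction hr : M.rkNat X using Nat.strong_induction_on generalizing M X with
  | _ r ih =>
  obtain rfl | ⟨e, he⟩ := X.eq_empty_or_nonempty
  · simp [Nat.one_le_pow _ _ hq]
  have hXfin : X.Finite := M.ground_finite.subset hXE
  have heM : M.IsNonloop e := by simpa using hX e he e he
  let P : Set α → Prop := fun Y ↦ Y ⊆ X \ {e} ∧ ∀ a ∈ Y, ∀ b ∈ Y, (M ／ {e}).Indep {a, b}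
  have hfinP : {Y | P Y}.Finite := (hXfin.sdiff (t := {e})).finite_subsets.subset fun Y hY ↦ hY.1
  -- `Y` represents the points of `M ／ {e}` met by `X \ {e}`, that is, the lines through `e`. The
  -- induction bounds `Y`, and each line has at most `q` points of `X` other than `e`.
  obtain ⟨Y, hY⟩ := hfinP.exists_maximal ⟨∅, empty_subset _, by simp⟩
  obtain ⟨⟨hYX, hYi⟩, hYmax⟩ := hY
  have hYE : Y ⊆ (M ／ {e}).E := hYX.trans (sdiff_subset_sdiff_left hXE)
  have hYfin : Y.Finite := hXfin.sdiff.subset hYX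
  have hrY : (M ／ {e}).rkNat Y + 1 ≤ M.rkNat X := by
    rw [M.rkNat_contractElem heM]
    exact M.rkNat_mono (insert_subset he (hYX.trans sdiff_subset))
  have hbound := ih _ (by omega) (fun h ↦ hline (h.of_isMinor ⟨{e}, ∅, (delete_empty _).symm⟩)) hYE hYi rfl
  -- By maximality of `Y`, each `x` outside it is parallel in `M ／ {e}` to some `y ∈ Y`, hence on
  -- the line through `e` and `y`.
  have hcover : X \ {e} ⊆ ⋃ y ∈ hYfin.toFinset, {x ∈ X \ {e} | M.rkNat {x, e, y} ≤ 2} := by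
    intro x hx
    simp only [Finite.mem_toFinset, mem_iUnion]
    by_contra! hcon
    have hindep (y) (hy : y ∈ Y) : (M ／ {e}).Indep {x, y} := by
      have h1 : 2 < M.rkNat {x, e, y} := not_le.1 fun h ↦ hcon y hy ⟨hx, h⟩
      have h2 := M.rkNat_contractElem heM {x, y}
      rw [insert_comm] at h2
      have h3 : ({x, y} : Set α).ncard ≤ 2 := by simpa using ncard_insert_le x {y}
      have h4 := (M ／ {e}).eRk_le_encard {x, y}
      rw [indep_iff_rkNat_eq_ncard (by simp)]
      rw [← coe_rkNat, ← Set.Finite.cast_ncard_eq (by simp)] at h4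
      norm_cast at h4
      omega
    have hxx : (M ／ {e}).Indep {x, x} := by
      rw [pair_eq_singleton, heM.indep.contract_indep_iff]
      refine ⟨by simpa using hx.2, ?_⟩
      rw [singleton_union]
      exact hX x hx.1 e he
    have hxY : x ∈ Y := hYmax (y := insert x Y) ⟨insert_subset hx hYX, by
      rintro a (rfl | ha) b (rfl | hb)
      · exact hxx
      · exact hindep b hb
      · rw [pair_comm]
        exact hindep a ha
      · exact hYi a ha b hb⟩ (subset_insert _ _) (mem_insert _ _)
    refine hcon x hxY ⟨hx, ?_⟩
    rw [insert_comm, pair_eq_singleton, pair_comm, (hX x hx.1 e he).rkNat_eq]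
    simpa using ncard_insert_le x {e}
  have hcard : (X \ {e}).ncard ≤ Y.ncard * q := by
    refine (ncard_le_ncard hcover ?_).trans ?_
    · exact hXfin.sdiff.subset (iUnion₂_subset fun y _ ↦ sep_subset _ _)
    refine (Finset.set_ncard_biUnion_le _ _).trans ?_
    rw [ncard_eq_toFinset_card _ hYfin]
    refine Finset.sum_le_card_nsmul _ _ _ fun y hy ↦ ?_
    have hyX := hYX (hYfin.mem_toFinset.1 hy)
    exact ncard_line_le hline hXE hX he hyX.1 (Ne.symm hyX.2)
  rw [← ncard_sdiff_singleton_add_one he hXfin]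
  have hpow : q ^ ((M ／ {e}).rkNat Y + 1) ≤ q ^ r := Nat.pow_le_pow_right hq (hr ▸ hrY)
  refine le_trans ?_ hpow
  obtain ⟨p, rfl⟩ := Nat.exists_eq_add_of_le' hq
  simp only [Nat.add_sub_cancel] at hbound ⊢
  rw [pow_succ]
  -- With `p = q - 1`: `p(q|Y| + 1) + 1 = q(p|Y| + 1)`.
  nlinarith [Nat.mul_le_mul_left p hcard, Nat.mul_le_mul_right (p + 1) hbound]

/-! ### Cocircuits and the characteristic polynomial -/

lemma deleteElem_isMinor (M : Matroid α) (e : α) : M ＼ {e} ≤m M :=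
  ⟨∅, {e}, by rw [contract_empty]⟩

lemma contractElem_isMinor (M : Matroid α) (e : α) : M ／ {e} ≤m M :=
  ⟨{e}, ∅, (delete_empty _).symm⟩

lemma deleteElem_isStrictMinor (he : e ∈ M.E) : M ＼ {e} <m M :=
  isStrictMinor_iff_isMinor_ssubset.2 ⟨M.deleteElem_isMinor e, by simpa using he⟩

lemma contractElem_isStrictMinor (he : e ∈ M.E) : M ／ {e} <m M :=
  isStrictMinor_iff_isMinor_ssubset.2 ⟨M.contractElem_isMinor e, by simpa using he⟩

lemma delete_insert (M : Matroid α) (e : α) (X : Set α) : M ＼ (insert e X) = M ＼ {e} ＼ X := by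
  rw [delete_delete, singleton_union]

/-- Deleting a set with spanning complement does not decrease the characteristic polynomial at
`x`, as long as the characteristic polynomials of all minors are nonnegative at `x`. -/
lemma charSum_le_charSum_delete [M.Finite] {x : ℝ}
    (hx : ∀ (N : Matroid α) [N.Finite], N ≤m M → 0 ≤ N.charSum x) (hX : X.Finite)
    (hr : M.rkNat (M.E \ X) = M.rkNat M.E) : M.charSum x ≤ (M ＼ X).charSum x := by
  induction X, hX using Set.Finite.induction_on generalizing M with
  | empty => simp only [delete_empty, le_refl]
  | @insert e X _ _ ih =>
    have hr' : M.rkNat (M.E \ {e}) = M.rkNat M.E :=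
      le_antisymm (M.rkNat_le_ground _) (hr.ge.trans (M.rkNat_mono
        (sdiff_subset_sdiff_right (singleton_subset_iff.2 (mem_insert _ _)))))
    simp only [delete_insert]
    refine le_trans ?_ (ih (fun N _ hN ↦ hx N (hN.trans (M.deleteElem_isMinor e))) ?_)
    · by_cases he : e ∈ M.E
      · obtain hl | hl := M.isLoop_or_isNonloop e
        · rw [charSum_eq_zero_of_isLoop hl]
          exact hx _ (M.deleteElem_isMinor e)
        · rw [charSum_eq_delete_sub_contract hl hr']
          linarith [hx _ (M.contractElem_isMinor e)]
      · simp only [deleteElem_eq_self he, le_refl]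
    · rw [rkNat_ground_delete, hr', rkNat_delete, ← hr]
      congr 1
      ext a
      simp
      grind

/-- If `X` is a cocircuit of `M`, then the characteristic polynomial of `M` at `x` is at least
`x - |X|` times that of `M ＼ X`, as long as the characteristic polynomials of all strict minors
are nonnegative at `x`. -/
lemma le_charSum_of_cocircuit [M.Finite] {x : ℝ}
    (hx : ∀ (N : Matroid α) [N.Finite], N <m M → 0 ≤ N.charSum x) (hX : X.Finite)
    (hXE : X ⊆ M.E) (hne : X.Nonempty) (hr : M.rkNat (M.E \ X) + 1 = M.rkNat M.E)
    (hins : ∀ e ∈ X, M.rkNat (insert e (M.E \ X)) = M.rkNat M.E) :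
    (x - X.ncard) * (M ＼ X).charSum x ≤ M.charSum x := by
  induction X, hX using Set.Finite.induction_on generalizing M with
  | empty => simp at hne
  | @insert e X heX hX ih =>
    have he : e ∈ M.E := hXE (mem_insert _ _)
    obtain rfl | ⟨f, hf⟩ := X.eq_empty_or_nonempty
    · rw [insert_empty_eq] at hr
      simp only [insert_empty_eq]
      rw [charSum_eq_of_coloop he hr, ncard_singleton, Nat.cast_one]
    have hfe : f ≠ e := fun h ↦ heX (h ▸ hf)
    have henl : M.IsNonloop e := isNonloop_of_rkNat_lt_insert (X := M.E \ insert e X) (by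
      rw [hins e (mem_insert _ _)]
      omega)
    have hr' : M.rkNat (M.E \ {e}) = M.rkNat M.E := by
      refine le_antisymm (M.rkNat_le_ground _) ?_
      rw [← hins f (mem_insert_of_mem _ hf)]
      refine M.rkNat_mono (insert_subset ⟨hXE (mem_insert_of_mem _ hf), hfe⟩ ?_)
      exact sdiff_subset_sdiff_right (singleton_subset_iff.2 (mem_insert _ _))
    have hsd : (M ＼ {e}).E \ X = M.E \ insert e X := by
      rw [delete_ground, sdiff_sdiff, singleton_union]
    have hne' : e ∉ M.E \ insert e X := fun h ↦ h.2 (mem_insert _ _)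
    -- `X` is a cocircuit of `M ＼ {e}`, so the deletion term gives the factor `x - |X|`. The
    -- contraction term costs at most one further copy of the value for `M ＼ insert e X`, giving `x
    -- - (|X| + 1)`.
    have hdel := ih (M := M ＼ {e})
      (fun N _ hN ↦ hx N (hN.trans_isMinor (M.deleteElem_isMinor e)))
      (fun a ha ↦ ⟨hXE (mem_insert_of_mem _ ha), fun h ↦ heX (h ▸ ha)⟩) ⟨f, hf⟩
      (by rw [hsd, rkNat_delete, sdiff_singleton_eq_self hne', rkNat_ground_delete, hr', hr])
      (fun a ha ↦ by
        rw [hsd, rkNat_delete, sdiff_singleton_eq_self, rkNat_ground_delete, hr',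
          hins a (mem_insert_of_mem _ ha)]
        rintro (rfl | h)
        · exact heX ha
        · exact hne' h)
    have hcon : (M ／ {e}).charSum x ≤ (M ／ {e} ＼ X).charSum x := by
      refine charSum_le_charSum_delete
        (fun N _ hN ↦ hx N (hN.trans_isStrictMinor (contractElem_isStrictMinor he))) hX ?_
      have h1 := M.rkNat_contractElem henl ((M ／ {e}).E \ X)
      have h2 := M.rkNat_contractElem henl (M ／ {e}).E
      rw [contract_ground, insert_sdiff_singleton, insert_eq_of_mem he] at h2
      rw [contract_ground, sdiff_sdiff, singleton_union, hins e (mem_insert _ _), ← h2] at h1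
      rw [contract_ground, sdiff_sdiff, singleton_union]
      omega
    -- Once `X` is deleted, `e` is a coloop, and contracting a coloop is the same as deleting it.
    have hcol : M ／ {e} ＼ X = M ＼ insert e X := by
      rw [contract_delete_comm _ (by simpa using heX), contract_eq_delete_of_subset_coloops,
        delete_delete, union_comm, singleton_union]
      rw [singleton_subset_iff]
      change (M ＼ X).IsColoop e
      rw [isColoop_iff_notMem_closure_compl (show e ∈ M.E \ X from ⟨he, heX⟩)]
      intro hmem
      have h1 := rkNat_closure (M ＼ X) (insert e ((M ＼ X).E \ {e}))
      rw [closure_insert_eq_of_mem_closure hmem, rkNat_closure, rkNat_delete, rkNat_delete] at h1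
      have h2 : ((M ＼ X).E \ {e}) \ X = M.E \ insert e X := by ext a; simp; grind
      have h3 : insert e ((M ＼ X).E \ {e}) \ X = insert e (M.E \ insert e X) := by
        ext a; simp; grind
      rw [h2, h3, hins e (mem_insert _ _)] at h1
      omega
    simp only [hcol] at hcon
    simp only [← delete_insert] at hdel
    rw [charSum_eq_delete_sub_contract henl hr', ncard_insert_of_notMem heX hX]
    push_cast
    linarith

/-- A set with nonspanning complement contains a cocircuit, given as the complement of a
hyperplane. -/
lemma exists_cocircuit_subset [M.Finite] {L : Set α} (hL : M.rkNat (M.E \ L) < M.rkNat M.E) :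
    ∃ X ⊆ M.E ∩ L, X.Nonempty ∧ M.rkNat (M.E \ X) + 1 = M.rkNat M.E ∧
      ∀ e ∈ X, M.rkNat (insert e (M.E \ X)) = M.rkNat M.E := by
  have hfin : {H | H ⊆ M.E ∧ M.rkNat H < M.rkNat M.E}.Finite :=
    M.ground_finite.finite_subsets.subset fun H hH ↦ hH.1
  -- A maximal nonspanning set containing `M.E \ L` is a hyperplane; its complement is a cocircuit
  -- inside `L`.
  obtain ⟨H, hLH, ⟨hHE, hHr⟩, hmax⟩ := hfin.exists_le_maximal (a := M.E \ L) ⟨sdiff_subset, hL⟩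
  have hins : ∀ e ∈ M.E \ H, M.rkNat (insert e H) = M.rkNat M.E := by
    intro e he
    refine le_antisymm (M.rkNat_le_ground _) (not_lt.1 fun hlt ↦ he.2 ?_)
    exact hmax (y := insert e H) ⟨insert_subset he.1 hHE, hlt⟩ (subset_insert _ _)
      (mem_insert _ _)
  have hne : (M.E \ H).Nonempty := by
    rw [nonempty_iff_ne_empty, Ne, sdiff_eq_empty]
    exact fun h ↦ hHr.not_ge (M.rkNat_mono h)
  refine ⟨M.E \ H, fun a ha ↦ ⟨ha.1, ?_⟩, hne, ?_, ?_⟩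
  · by_contra haL
    exact ha.2 (hLH ⟨ha.1, haL⟩)
  · rw [sdiff_sdiff_cancel_left hHE]
    obtain ⟨e, he⟩ := hne
    have := hins e he
    have := M.rkNat_insert_le e H
    omega
  · rwa [sdiff_sdiff_cancel_left hHE]

lemma charSum_eq_one_of_ground_eq_empty [M.Finite] (h : M.E = ∅) (x : ℝ) : M.charSum x = 1 := by
  have h' : M.ground_finite.toFinset = ∅ := by simpa using h
  rw [charSum, h']
  simp [h]

lemma Loopless.of_delete [M.Loopless] (X : Set α) : (M ＼ X).Loopless := by
  rw [loopless_iff_forall_not_isLoop]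
  intro e _ h
  exact M.not_isLoop e (delete_isLoop_iff.1 h).1

/-- Deleting one of two parallel elements does not change the characteristic polynomial. -/
lemma charSum_eq_delete_of_parallel [M.Finite] [M.Loopless] (he : e ∈ M.E) (hf : f ∈ M.E)
    (hef : ¬ M.Indep {e, f}) (x : ℝ) : M.charSum x = (M ＼ {f}).charSum x := by
  have hne : e ≠ f := by
    rintro rfl
    exact hef (by simpa using M.isNonloop_of_loopless he)
  have henl := M.isNonloop_of_loopless he
  have hfnl := M.isNonloop_of_loopless hf
  have hcl (a b) (hb : M.IsNonloop b) (ha : a ∈ M.E) (h : ¬ M.Indep {a, b}) :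
      a ∈ M.closure {b} := by
    by_contra hcon
    refine h ((hb.indep.insert_indep_iff).2 (Or.inl ⟨ha, hcon⟩))
  have h1 : (M ／ {f}).IsLoop e :=
    contract_isLoop_iff_mem_closure.2 ⟨hcl e f hfnl he hef, hne⟩
  have h2 : f ∈ M.closure (M.E \ {f}) := by
    refine M.closure_subset_closure ?_ (hcl f e henl hf (by rwa [pair_comm]))
    exact singleton_subset_iff.2 ⟨he, hne⟩
  have h3 : M.rkNat (M.E \ {f}) = M.rkNat M.E := by
    rw [← rkNat_closure, ← closure_insert_eq_of_mem_closure h2, rkNat_closure,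
      insert_sdiff_singleton, insert_eq_of_mem hf]
  rw [charSum_eq_delete_sub_contract hfnl h3, charSum_eq_zero_of_isLoop h1, sub_zero]

/-! ### The induction for positivity -/

theorem charSum_pos [M.Finite] [M.Loopless] {q k : ℕ} (hq : 2 ≤ q)
    (htd : M.HasTreeDecompositionOfWidthLE k)
    (hline : ¬ M.HasMinorIsomorphicTo (uniform 2 (q + 2))) {x : ℝ}
    (hx : ((q : ℝ) ^ k - 1) / ((q : ℝ) - 1) < x) : 0 < M.charSum x := by
  induction hn : M.E.ncard using Nat.strong_induction_on generalizing M with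
  | _ n ih =>
  have hpos (N : Matroid α) [N.Finite] [N.Loopless] (hN : N <m M) : 0 < N.charSum x :=
    ih _ (hn ▸ ncard_lt_ncard hN.ssubset M.ground_finite) (htd.of_isMinor hN.isMinor)
      (fun h ↦ hline (h.of_isMinor hN.isMinor)) rfl
  have hnonneg (N : Matroid α) [N.Finite] (hN : N <m M) : 0 ≤ N.charSum x := by
    by_cases hl : N.Loopless
    · exact (hpos N hN).le
    · rw [loopless_iff_forall_not_isLoop] at hl
      push Not at hl
      obtain ⟨e, -, he⟩ := hl
      rw [charSum_eq_zero_of_isLoop he]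
  by_cases hsimple : ∀ e ∈ M.E, ∀ f ∈ M.E, M.Indep {e, f}
  swap
  · push Not at hsimple
    obtain ⟨e, he, f, hf, hef⟩ := hsimple
    rw [charSum_eq_delete_of_parallel he hf hef]
    have := Loopless.of_delete (M := M) {f}
    exact hpos _ (deleteElem_isStrictMinor hf)
  obtain hE | ⟨e, he⟩ := M.E.eq_empty_or_nonempty
  · rw [charSum_eq_one_of_ground_eq_empty hE]
    exact one_pos
  have hr : 0 < M.rkNat M.E := by
    have := M.rkNat_le_ground {e}
    rw [(M.isNonloop_of_loopless he).rkNat_eq] at this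
    omega
  obtain ⟨m, D, hD⟩ := htd
  obtain ⟨L, hLE, hLk, hLr⟩ := D.exists_nonspanning_compl hD hr
  obtain ⟨X, hXL, hXne, hXr, hXins⟩ := exists_cocircuit_subset hLr
  have hXE : X ⊆ M.E := hXL.trans inter_subset_left
  have hXfin : X.Finite := M.ground_finite.subset hXE
  have hdel : M ＼ X <m M := by
    refine isStrictMinor_iff_isMinor_ssubset.2 ⟨⟨∅, X, by rw [contract_empty]⟩, ?_⟩
    obtain ⟨a, ha⟩ := hXne
    exact (ssubset_iff_of_subset sdiff_subset).2 ⟨a, hXE ha, fun h ↦ h.2 ha⟩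
  have := Loopless.of_delete (M := M) X
  refine lt_of_lt_of_le (mul_pos (sub_pos.2 (lt_of_le_of_lt ?_ hx)) (hpos _ hdel))
    (le_charSum_of_cocircuit hnonneg hXfin hXE hXne hXr hXins)
  have hq' : (0 : ℝ) < (q : ℝ) - 1 := by
    have : (2 : ℝ) ≤ q := by exact_mod_cast hq
    linarith
  rw [le_div_iff₀ hq']
  -- The cocircuit `X` lies in `L`, so it has rank at most `k`; Kung's bound then gives `(q - 1)|X|
  -- + 1 ≤ q ^ k`.
  have hkung := ncard_le_of_not_hasMinorIsomorphicTo_uniform (by omega) hline hXE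
    fun a ha b hb ↦ hsimple a (hXE ha) b (hXE hb)
  have hXk : M.rkNat X ≤ k := by
    have := M.rkNat_mono (hXL.trans inter_subset_right)
    omega
  have hle := hkung.trans (Nat.pow_le_pow_right (by omega) hXk)
  have hcast : (((q - 1) * X.ncard + 1 : ℕ) : ℝ) ≤ ((q ^ k : ℕ) : ℝ) := by exact_mod_cast hle
  push_cast [Nat.cast_sub (show 1 ≤ q by omega)] at hcast
  linarith

end Matroid

theorem theorem1p4 {α : Type*} (M : Matroid α) [M.Finite] (q k : ℕ) (hq : 2 ≤ q)
    (htw : M.treeWidth ≤ k)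
    (hline : ¬ M.HasMinorIsomorphicTo (Matroid.uniform 2 (q + 2))) :
    M.charPolynomial = 0 ∨
      ∀ x : ℝ, ((q : ℝ) ^ k - 1) / ((q : ℝ) - 1) < x → 0 < M.charPolynomial.eval x := by
  by_cases hl : M.Loopless
  · refine Or.inr fun x hx ↦ ?_
    rw [Matroid.eval_charPolynomial]
    exact Matroid.charSum_pos hq (Matroid.hasTreeDecompositionOfWidthLE_of_treeWidth_le htw)
      hline hx
  · exact Or.inl (if_neg hl)
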